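/- **Theorem 3.1.** Let $E,F$ be Banach spaces (both real or both complex), let $f:U\to F$ be a $c^1$ map on an open set $U\subset E$, and let $x_0\in U$ be a generalized regular point of $f$. By this we mean the following: $T_0:=f'(x_0)$ is double splitting (that is, $R(T_0)$ is closed, and $N(T_0)$ and $R(T_0)$ have closed complements in $E$ and $F$), and there are a generalized inverse $T_0^+\in B(F,E)$ of $T_0$ (that is, $T_0^+T_0T_0^+=T_0^+$ and $T_0T_0^+T_0=T_0$) and a neighbourhood $V$ of $x_0$ with $R(f'(x))\cap N(T_0^+)=\{0\}$ for all $x\in V$. Let $U_0\subset U$ be any open neighbourhood of $x_0$ (for instance $U_0=U$), and consider the family of subspaces $\mathcal F=\{N(f'(x)):x\in U_0\}$. Then: 1. For every generalized inverse $T_0^+$ of $T_0$, with $E_*:=R(T_0^+)$, the co-final set $$J(x_0,E_*)=\{x\in U_0: N(f'(x))\oplus E_*=E\}$$ is trivial. That is, $x_0$ is an interior point of $J(x_0,E_*)$, and the coordinate operator $\alpha(x)\in B(N(f'(x_0)),E_*)$, $x\in J(x_0,E_*)$, which is uniquely determined by $N(f'(x))=\{e+\alpha(x)e: e\in N(f'(x_0))\}$,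 is continuous (in the operator norm) on some neighbourhood of $x_0$. 2. $\mathcal F$ is $c^1$ integrable at $x_0$. That is, there is a $c^1$ submanifold $S$ of $E$ with $x_0\in S\subset U_0$ such that for every $x\in S$ $$N(f'(x))=\{\dot c(0): c \text{ a } c^1\text{-curve in } S \text{ defined near } 0\in\mathbb R,\ c(0)=x\}.$$ Here $S\subset E$ is a $c^1$ submanifold if for each $x\in S$ there are closed subspaces $E_0,E_1$ with $E=E_0\oplus E_1$ and a $c^1$ diffeomorphism $\varphi$ of an open neighbourhood $W$ of $x$ in $E$ onto an open subset of $E$ such that $\varphi(S\cap W)$ is an open subset of $E_0$. -/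

import Mathlib

open Set Filter Topology

/-- `E = M ⊕ N` as Banach spaces: `M` and `N` are closed complementary subspaces of `E`. -/
def IsSplitting {𝕜 E : Type*} [RCLike 𝕜] [NormedAddCommGroup E] [NormedSpace 𝕜 E]
    (M N : Submodule 𝕜 E) : Prop :=
  IsClosed (M : Set E) ∧ IsClosed (N : Set E) ∧ IsCompl M N

/-- `B` is a generalized inverse of `A`: `B A B = B` and `A B A = A`. -/
def IsGeneralizedInverse {𝕜 E F : Type*} [RCLike 𝕜]
    [NormedAddCommGroup E] [NormedSpace 𝕜 E] [NormedAddCommGroup F] [NormedSpace 𝕜 F]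
    (A : E →L[𝕜] F) (B : F →L[𝕜] E) : Prop :=
  B ∘L A ∘L B = B ∧ A ∘L B ∘L A = A

/-- `A` is double splitting: its range is closed, and its kernel and its range have closed
complements. -/
def IsDoubleSplitting {𝕜 E F : Type*} [RCLike 𝕜]
    [NormedAddCommGroup E] [NormedSpace 𝕜 E] [NormedAddCommGroup F] [NormedSpace 𝕜 F]
    (A : E →L[𝕜] F) : Prop :=
  IsClosed (LinearMap.range (A : E →ₗ[𝕜] F) : Set F) ∧
    (∃ R : Submodule 𝕜 E, IsSplitting (LinearMap.ker (A : E →ₗ[𝕜] F)) R) ∧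
    ∃ N : Submodule 𝕜 F, IsSplitting (LinearMap.range (A : E →ₗ[𝕜] F)) N

/-- `x₀` is a locally fine point of the operator valued map `T`: `T` is continuous at `x₀`,
`T x₀` is double splitting, and for some generalized inverse `B` of `T x₀` one has
`R(T x) ∩ N(B) = {0}` for all `x` in a neighbourhood of `x₀`. -/
def IsLocallyFinePoint {X 𝕜 E F : Type*} [TopologicalSpace X] [RCLike 𝕜]
    [NormedAddCommGroup E] [NormedSpace 𝕜 E] [NormedAddCommGroup F] [NormedSpace 𝕜 F]
    (T : X → E →L[𝕜] F) (x₀ : X) : Prop :=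
  ContinuousAt T x₀ ∧ IsDoubleSplitting (T x₀) ∧
    ∃ B : F →L[𝕜] E, IsGeneralizedInverse (T x₀) B ∧
      ∃ V ∈ 𝓝 x₀, ∀ x ∈ V,
        LinearMap.range (T x : E →ₗ[𝕜] F) ⊓ LinearMap.ker (B : F →ₗ[𝕜] E) = ⊥

/-- `x₀` is a generalized regular point of `f`, i.e. a locally fine point of `x ↦ f'(x)`.
It is used for `f` of class `c¹` on an open set that contains `x₀`, so that the values of
`fderiv 𝕜 f` near `x₀` are the derivatives of `f`. -/
def IsGeneralizedRegularPoint (𝕜 : Type*) {E F : Type*} [RCLike 𝕜]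
    [NormedAddCommGroup E] [NormedSpace 𝕜 E] [NormedAddCommGroup F] [NormedSpace 𝕜 F]
    (f : E → F) (x₀ : E) : Prop :=
  IsLocallyFinePoint (fun x : E => fderiv 𝕜 f x) x₀

/-- The kernel family `x ↦ N(f'(x))`. -/
noncomputable def kernelFamily (𝕜 : Type*) {E F : Type*} [RCLike 𝕜]
    [NormedAddCommGroup E] [NormedSpace 𝕜 E] [NormedAddCommGroup F] [NormedSpace 𝕜 F]
    (f : E → F) (x : E) : Submodule 𝕜 E :=
  LinearMap.ker (fderiv 𝕜 f x : E →ₗ[𝕜] F)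

/-- The co-final set `J(x₀, Es) = {x ∈ Λ : M(x) ⊕ Es = E}` of the family `{M(x) : x ∈ Λ}`.
(The base point enters only through the requirement `M(x₀) ⊕ Es = E`, that is, that `x₀`
belongs to this set.) -/
def cofinalSet {𝕜 E : Type*} [RCLike 𝕜] [NormedAddCommGroup E] [NormedSpace 𝕜 E]
    (Λ : Set E) (M : E → Submodule 𝕜 E) (Es : Submodule 𝕜 E) : Set E :=
  {x | x ∈ Λ ∧ IsSplitting (M x) Es}

/-- `α ∈ B(E₀, Es)` is the coordinate operator of the subspace `E₁`:
`E₁ = {e + α e : e ∈ E₀}`. -/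
def IsCoordinateOperator {𝕜 E : Type*} [RCLike 𝕜] [NormedAddCommGroup E] [NormedSpace 𝕜 E]
    {E₀ Es : Submodule 𝕜 E} (E₁ : Submodule 𝕜 E) (α : E₀ →L[𝕜] Es) : Prop :=
  (E₁ : Set E) = {v | ∃ e : E₀, v = (e : E) + (α e : E)}

/-- The coordinate operator is unique when `E = E₀ ⊕ Es`. -/
theorem IsCoordinateOperator.unique {𝕜 E : Type*} [RCLike 𝕜] [NormedAddCommGroup E]
    [NormedSpace 𝕜 E] {E₀ Es E₁ : Submodule 𝕜 E} (h : IsSplitting E₀ Es)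
    {α β : E₀ →L[𝕜] Es} (hα : IsCoordinateOperator E₁ α) (hβ : IsCoordinateOperator E₁ β) :
    α = β := by
  ext e
  have h1 : (e : E) + (α e : E) ∈ (E₁ : Set E) := by
    rw [hα]; exact ⟨e, rfl⟩
  rw [hβ] at h1
  obtain ⟨e', he'⟩ := h1
  have h2 : ((e - e' : E₀) : E) = ((β e' - α e : Es) : E) := by
    push_cast
    rw [sub_eq_sub_iff_add_eq_add, he', add_comm]
  have h3 : ((e - e' : E₀) : E) = 0 :=
    Submodule.disjoint_def.1 h.2.2.disjoint _ (e - e').2 (h2 ▸ (β e' - α e).2)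
  have h4 : e = e' := sub_eq_zero.1 (Subtype.ext h3)
  subst h4
  exact add_left_cancel he'

/-- The co-final set `J(x₀, Es)` is trivial: `x₀` is an inner point of it, and the coordinate
operator `α(x) ∈ B(M(x₀), Es)` of `M(x)`, `x ∈ J(x₀, Es)`, is continuous (for the operator norm)
in some neighbourhood of `x₀`. The values of `α` on `J(x₀, Es)` are unique, those outside of it
play no role. -/
def IsTrivialCofinalSet {𝕜 E : Type*} [RCLike 𝕜] [NormedAddCommGroup E] [NormedSpace 𝕜 E]
    (Λ : Set E) (M : E → Submodule 𝕜 E) (x₀ : E) (Es : Submodule 𝕜 E) : Prop :=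
  x₀ ∈ interior (cofinalSet Λ M Es) ∧
    ∃ α : E → (M x₀ →L[𝕜] Es),
      (∀ x ∈ cofinalSet Λ M Es, IsCoordinateOperator (M x) (α x)) ∧
      ∃ V ∈ 𝓝 x₀, V ⊆ cofinalSet Λ M Es ∧ ContinuousOn α V

/-- `S` is a `c¹` submanifold of the Banach space `E`: around each of its points there is a `c¹`
diffeomorphism `φ` between open sets of `E` that maps the part of `S` in its domain onto an open
set of a subspace `E₀` that splits in `E`. -/
def IsC1Submanifold (𝕜 : Type*) {E : Type*} [RCLike 𝕜] [NormedAddCommGroup E] [NormedSpace 𝕜 E]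
    (S : Set E) : Prop :=
  ∀ x ∈ S, ∃ E₀ E₁ : Submodule 𝕜 E, IsSplitting E₀ E₁ ∧
    ∃ φ : OpenPartialHomeomorph E E, x ∈ φ.source ∧
      ContDiffOn 𝕜 1 φ φ.source ∧ ContDiffOn 𝕜 1 φ.symm φ.target ∧
      ∃ W : Set E, IsOpen W ∧ φ '' (S ∩ φ.source) = W ∩ (E₀ : Set E)

/-- The set of velocities `c'(0)` of the `c¹` curves `c : (-ε, ε) → E` in `S` with `c 0 = x`. -/
def tangentSet {E : Type*} [NormedAddCommGroup E] [NormedSpace ℝ E] (S : Set E) (x : E) :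
    Set E :=
  {v | ∃ c : ℝ → E, ∃ ε > 0, ContDiffOn ℝ 1 c (Ioo (-ε) ε) ∧ (∀ t ∈ Ioo (-ε) ε, c t ∈ S) ∧
    c 0 = x ∧ HasDerivAt c v 0}

/-- The family `{M(x) : x ∈ Λ}` is `c¹` integrable at `x₀`: there is a `c¹` submanifold `S ⊆ Λ`
through `x₀` (the integral submanifold) that is tangent to `M(x)` at each of its points `x`. -/
def IsC1IntegrableAt {𝕜 E : Type*} [RCLike 𝕜] [NormedAddCommGroup E] [NormedSpace 𝕜 E]
    [NormedSpace ℝ E] (Λ : Set E) (M : E → Submodule 𝕜 E) (x₀ : E) : Prop :=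
  ∃ S : Set E, S ⊆ Λ ∧ x₀ ∈ S ∧ IsC1Submanifold 𝕜 S ∧
    ∀ x ∈ S, (M x : Set E) = tangentSet S x

/-! Let `B` be the generalized inverse in the regularity condition. Since `R(T x) ∩ N(B) = 0` near
`x₀`, one has `N(T x) = N(B T x)` there, so `T x` may be replaced by operators with values in a
fixed complement of `N(T x₀)`. Let `P` be the projection onto such a complement along `N(T x₀)`, and
`Q` close to `P` with `P Q = Q`. Then `D = 1 - P + Q` is close to `1`, hence invertible, and `P D =
Q`, so `D` carries `N(Q)` onto `N(P)`. As also `(1 - P) D = 1 - P`, the kernel `N(Q)` is the graph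
of `-D⁻¹ Q` over `N(P)`, which depends continuously on `Q`
(`isCoordinateOperator_ker_of_isUnit_intertwiner`).

For integrability, put `R = B T x₀` and `φ x = (1 - R)(x - x₀) + B (f x - f x₀)`. Its derivative has
the form `D` and is the identity at `x₀`, so `φ` is a local diffeomorphism, and `R φ = B (f - f
x₀)`. The integral submanifold is `φ⁻¹(N(R))`, locally the zero set of `B (f - f x₀)`; its tangent
space at `x` is `N(B f'(x)) = N(f'(x))`. -/

open scoped Ring

/-! ### Splittings, coordinate operators and perturbed projections -/

section Splitting

variable {𝕜 E F : Type*} [RCLike 𝕜] [NormedAddCommGroup E] [NormedSpace 𝕜 E]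
  [NormedAddCommGroup F] [NormedSpace 𝕜 F]

/-- If `E = E₀ ⊕ Es = E₁ ⊕ Es` topologically, then `E₁` has a coordinate operator. -/
theorem IsSplitting.exists_isCoordinateOperator [CompleteSpace E] {E₀ E₁ Es : Submodule 𝕜 E}
    (h₀ : IsSplitting E₀ Es) (h₁ : IsSplitting E₁ Es) :
    ∃ α : E₀ →L[𝕜] Es, IsCoordinateOperator E₁ α := by
  have ht : Submodule.IsTopCompl Es E₁ := Submodule.IsCompl.isTopCompl_of_isClosed h₁.2.2.symm h₁.2.1 h₁.1
  set p := Es.projectionOntoL E₁ ht with hp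
  have hpE : ∀ s : Es, p (s : E) = s := fun s => Submodule.projectionOntoL_apply_left ht s
  have hp0 : ∀ v, p v = 0 ↔ v ∈ E₁ := fun v => Submodule.projectionOntoL_apply_eq_zero_iff ht
  -- `p` is the projection onto `Es` along `E₁`, so `e + s` with `s ∈ Es` lies in `E₁` exactly when
  -- `s = -p e`.
  refine ⟨-(p ∘L E₀.subtypeL), ?_⟩
  ext v
  simp only [SetLike.mem_coe, Set.mem_ofPred_eq]
  constructor
  · intro hv
    obtain ⟨e, he, s, hs, rfl⟩ := Submodule.mem_sup.1 (h₀.2.2.sup_eq_top ▸ Submodule.mem_top (x := v))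
    refine ⟨⟨e, he⟩, ?_⟩
    have h := (hp0 _).2 hv
    rw [map_add, hpE ⟨s, hs⟩, add_eq_zero_iff_neg_eq] at h
    simp [h]
  · rintro ⟨e, rfl⟩
    rw [← hp0, map_add, hpE]
    simp

/-- The operator `1 - P + Q`, which intertwines `Q` with the projection `P` when `P Q = Q`. -/
noncomputable def intertwiner (P Q : E →L[𝕜] E) : E →L[𝕜] E := 1 - P + Q

theorem mul_intertwiner {P Q : E →L[𝕜] E} (hP : P * P = P) (hQ : P * Q = Q) :
    P * intertwiner P Q = Q := by
  rw [intertwiner, mul_add, mul_sub, mul_one, hP, hQ, sub_self, zero_add]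

theorem sub_mul_intertwiner {P Q : E →L[𝕜] E} (hP : P * P = P) (hQ : P * Q = Q) :
    (1 - P) * intertwiner P Q = 1 - P := by
  rw [sub_mul, mul_intertwiner hP hQ, one_mul, intertwiner, add_sub_cancel_right]

/-- Since `(1 - P) D = 1 - P`, the inverse of `D` also preserves the `1 - P` component. This is what
places the values of the graph operator `-D⁻¹ Q` in `R(P)`. -/
theorem mul_inverse_intertwiner {P Q : E →L[𝕜] E} (hP : P * P = P) (hQ : P * Q = Q)
    (hD : IsUnit (intertwiner P Q)) :
    P * ((intertwiner P Q)⁻¹ʳ * Q) = (intertwiner P Q)⁻¹ʳ * Q := by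
  set D := intertwiner P Q with hDdef
  have h : (1 - P) * D⁻¹ʳ = 1 - P := by
    calc (1 - P) * D⁻¹ʳ = ((1 - P) * D) * D⁻¹ʳ := by rw [hDdef, sub_mul_intertwiner hP hQ]
      _ = 1 - P := by rw [mul_assoc, Ring.mul_inverse_cancel _ hD, mul_one]
  have h2 : (1 - P) * (D⁻¹ʳ * Q) = 0 := by rw [← mul_assoc, h, sub_mul, one_mul, hQ, sub_self]
  rw [sub_mul, one_mul, sub_eq_zero] at h2
  exact h2.symm

/-- `D` vanishes on `N(Q) ∩ R(P)`, which is therefore zero; the decomposition is `v = (v - D⁻¹ Q v)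
+ D⁻¹ Q v`. -/
theorem isSplitting_ker_of_isUnit_intertwiner {P Q : E →L[𝕜] E} (hP : P * P = P)
    (hQ : P * Q = Q) (hD : IsUnit (intertwiner P Q)) :
    IsSplitting (LinearMap.ker (Q : E →ₗ[𝕜] E)) (LinearMap.range (P : E →ₗ[𝕜] E)) := by
  have hPv : ∀ v, P (P v) = P v := fun v => DFunLike.congr_fun hP v
  have hrange : ∀ v, v ∈ LinearMap.range (P : E →ₗ[𝕜] E) ↔ P v = v := by
    intro v
    exact ⟨by rintro ⟨w, rfl⟩; exact hPv w, fun h => ⟨v, h⟩⟩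
  set D := intertwiner P Q with hDdef
  have hDi : ∀ v, D⁻¹ʳ (D v) = v := fun v => DFunLike.congr_fun (Ring.inverse_mul_cancel _ hD) v
  have hPD : ∀ v, P (D v) = Q v := fun v => DFunLike.congr_fun (mul_intertwiner hP hQ) v
  have hDi' : ∀ v, D (D⁻¹ʳ v) = v := fun v => DFunLike.congr_fun (Ring.mul_inverse_cancel _ hD) v
  refine ⟨Q.isClosed_ker, ?_, ?_, ?_⟩
  · have : (LinearMap.range (P : E →ₗ[𝕜] E) : Set E) = {v | P v = v} := by
      ext v; exact hrange v
    rw [this]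
    exact isClosed_eq P.continuous continuous_id
  · rw [Submodule.disjoint_def]
    intro v hv hv'
    have hQv : Q v = 0 := hv
    have hDv : D v = 0 := by simp [hDdef, intertwiner, hQv, (hrange v).1 hv']
    rw [← hDi v, hDv, map_zero]
  · rw [codisjoint_iff, Submodule.eq_top_iff']
    intro v
    have hin : P (D⁻¹ʳ (Q v)) = D⁻¹ʳ (Q v) :=
      DFunLike.congr_fun (mul_inverse_intertwiner hP hQ hD) v
    rw [← sub_add_cancel v (D⁻¹ʳ (Q v))]
    refine Submodule.add_mem_sup ?_ ((hrange _).2 hin)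
    change Q _ = 0
    rw [← hPD, map_sub, hDi', map_sub, hPD]
    exact sub_eq_zero.2 (DFunLike.congr_fun hQ v).symm

/-- On `N(P)` one has `D e = e + Q e`, hence `D⁻¹ e = e - D⁻¹ Q e`; and `N(Q) = D⁻¹ N(P)`. -/
theorem isCoordinateOperator_ker_of_isUnit_intertwiner {P Q : E →L[𝕜] E} (hP : P * P = P)
    (hQ : P * Q = Q) (hD : IsUnit (intertwiner P Q)) {E₀ Es : Submodule 𝕜 E}
    (hE₀ : ∀ v, v ∈ E₀ ↔ P v = 0) (p : E →L[𝕜] Es) (hp : ∀ v, (p v : E) = P v) :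
    IsCoordinateOperator (LinearMap.ker (Q : E →ₗ[𝕜] E))
      (-(p ∘L ((intertwiner P Q)⁻¹ʳ * Q) ∘L E₀.subtypeL)) := by
  have hPv : ∀ v, P (P v) = P v := fun v => DFunLike.congr_fun hP v
  have hPi : ∀ v, P ((intertwiner P Q)⁻¹ʳ (Q v)) = (intertwiner P Q)⁻¹ʳ (Q v) := fun v =>
    DFunLike.congr_fun (mul_inverse_intertwiner hP hQ hD) v
  have hPD : ∀ v, P (intertwiner P Q v) = Q v := fun v =>
    DFunLike.congr_fun (mul_intertwiner hP hQ) v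
  have hDi : ∀ v, (intertwiner P Q)⁻¹ʳ (intertwiner P Q v) = v := fun v =>
    DFunLike.congr_fun (Ring.inverse_mul_cancel _ hD) v
  have hDi' : ∀ v, intertwiner P Q ((intertwiner P Q)⁻¹ʳ v) = v := fun v =>
    DFunLike.congr_fun (Ring.mul_inverse_cancel _ hD) v
  have hDe : ∀ e, P e = 0 → intertwiner P Q e = e + Q e := fun e he => by simp [intertwiner, he]
  ext v
  simp only [SetLike.mem_coe, Set.mem_ofPred_eq]
  constructor
  · intro hv
    have hQv : Q v = 0 := hv
    have he : P (v - P v) = 0 := by rw [map_sub, hPv, sub_self]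
    refine ⟨⟨v - P v, (hE₀ _).2 he⟩, ?_⟩
    have h1 : intertwiner P Q v = v - P v := by simp [intertwiner, hQv]
    have h2 : Q (v - P v) = intertwiner P Q (v - P v) - intertwiner P Q v := by
      rw [hDe _ he, h1, add_sub_cancel_left]
    have h3 : (intertwiner P Q)⁻¹ʳ (Q (v - P v)) = - P v := by
      rw [h2, map_sub, hDi, hDi]; abel
    change v = v - P v + ((-p ((intertwiner P Q)⁻¹ʳ (Q (v - P v))) : Es) : E)
    rw [h3, map_neg, neg_neg, hp, hPv, sub_add_cancel]
  · rintro ⟨e, rfl⟩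
    have he := (hE₀ e).1 e.2
    change Q _ = 0
    have : (((-(p ∘L ((intertwiner P Q)⁻¹ʳ * Q) ∘L E₀.subtypeL)) e : Es) : E)
        = -(intertwiner P Q)⁻¹ʳ (Q e) := by
      simp [hp, hPi]
    rw [this, ← hPD, map_add, map_neg, hDi', hDe _ he, add_neg_cancel_right, he]

theorem IsGeneralizedInverse.apply_left {A : E →L[𝕜] F} {B : F →L[𝕜] E}
    (h : IsGeneralizedInverse A B) (y : F) : B (A (B y)) = B y :=
  DFunLike.congr_fun h.1 y

theorem IsGeneralizedInverse.apply_right {A : E →L[𝕜] F} {B : F →L[𝕜] E}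
    (h : IsGeneralizedInverse A B) (v : E) : A (B (A v)) = A v :=
  DFunLike.congr_fun h.2 v

/-- Near a locally fine point the kernel of `T x` is that of `B ∘ T x`, for a suitable
generalized inverse `B` of `T x₀`. -/
theorem IsLocallyFinePoint.exists_ker_eq {X : Type*} [TopologicalSpace X] {T : X → E →L[𝕜] F}
    {x₀ : X} (h : IsLocallyFinePoint T x₀) :
    ∃ B : F →L[𝕜] E, IsGeneralizedInverse (T x₀) B ∧
      ∀ᶠ x in 𝓝 x₀, ∀ v, T x v = 0 ↔ B (T x v) = 0 := by
  obtain ⟨-, -, B, hB, V, hV, hVB⟩ := h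
  refine ⟨B, hB, Filter.mem_of_superset hV fun x hx v => ⟨fun h => by rw [h, map_zero], fun h => ?_⟩⟩
  have : T x v ∈ LinearMap.range (T x : E →ₗ[𝕜] F) ⊓ LinearMap.ker (B : F →ₗ[𝕜] E) :=
    ⟨⟨v, rfl⟩, h⟩
  rw [hVB x hx] at this
  exact this

end Splitting

/-! ### Triviality of the co-final set -/

section Kernels

variable {𝕜 E F : Type*} [RCLike 𝕜] [NormedAddCommGroup E] [NormedSpace 𝕜 E] [CompleteSpace E]
  [NormedAddCommGroup F] [NormedSpace 𝕜 F]

/-- The co-final set of the kernels of a continuous operator family is trivial at a locally fine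
point. -/
theorem isTrivialCofinalSet_ker {T : E → E →L[𝕜] F} {Λ : Set E} (hΛ : IsOpen Λ) {x₀ : E}
    (hx₀ : x₀ ∈ Λ) (hT : ContinuousOn T Λ) (hfine : IsLocallyFinePoint T x₀)
    {P : F →L[𝕜] E} (hP : IsGeneralizedInverse (T x₀) P) :
    IsTrivialCofinalSet Λ (fun x => LinearMap.ker (T x : E →ₗ[𝕜] F)) x₀
      (LinearMap.range (P : F →ₗ[𝕜] E)) := by
  obtain ⟨B, hB, hker⟩ := hfine.exists_ker_eq
  set A := T x₀ with hA
  set R : E →L[𝕜] E := P ∘L A with hR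
  -- The fineness condition is known for `B` only, while `P` is arbitrary. The factor `P A` is
  -- injective on `R(B)` and moves it into `R(P)`, without changing the kernel.
  set Q : E → E →L[𝕜] E := fun x => (P ∘L A ∘L B) ∘L T x with hQdef
  have hRR : R * R = R := by ext v; exact hP.apply_left (A v)
  have hRQ : ∀ x, R * Q x = Q x := fun x => by ext v; exact hP.apply_left (A (B (T x v)))
  have hrange : LinearMap.range (R : E →ₗ[𝕜] E) = LinearMap.range (P : F →ₗ[𝕜] E) := by
    ext v
    constructor
    · rintro ⟨w, rfl⟩; exact ⟨A w, rfl⟩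
    · rintro ⟨y, rfl⟩; exact ⟨P y, hP.apply_left y⟩
  have hkerR : ∀ v, v ∈ LinearMap.ker (T x₀ : E →ₗ[𝕜] F) ↔ R v = 0 := by
    intro v
    constructor
    · intro h
      have h' : A v = 0 := h
      simp [hR, h']
    · intro h
      change A v = 0
      have h' : P (A v) = 0 := h
      rw [← hP.apply_right v, h', map_zero]
  have hQc : ContinuousOn Q Λ := continuousOn_const.clm_comp hT
  have hDc : ContinuousOn (fun x => intertwiner R (Q x)) Λ := continuousOn_const.add hQc
  have hQ₀ : Q x₀ = R := by
    ext v
    simp [hQdef, hR, ← hA, hB.apply_right]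
  have hD₀ : intertwiner R (Q x₀) = 1 := by rw [hQ₀, intertwiner, sub_add_cancel]
  have hunit : ∀ᶠ x in 𝓝 x₀, IsUnit (intertwiner R (Q x)) :=
    (hDc.continuousAt (hΛ.mem_nhds hx₀)).eventually_mem
      (Units.isOpen.mem_nhds (by change IsUnit _; rw [hD₀]; exact isUnit_one))
  set V : Set E := {x | x ∈ Λ ∧ (∀ v, T x v = 0 ↔ B (T x v) = 0) ∧ IsUnit (intertwiner R (Q x))}
    with hVdef
  have hV : V ∈ 𝓝 x₀ := by
    filter_upwards [hΛ.mem_nhds hx₀, hker, hunit] with x h1 h2 h3 using ⟨h1, h2, h3⟩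
  have hkerQ : ∀ x ∈ V, LinearMap.ker (T x : E →ₗ[𝕜] F) = LinearMap.ker (Q x : E →ₗ[𝕜] E) := by
    intro x hx
    ext v
    change T x v = 0 ↔ P (A (B (T x v))) = 0
    constructor
    · intro h; simp [h]
    · intro h
      rw [hx.2.1, ← hB.apply_left, ← hP.apply_right, h, map_zero, map_zero]
  have hVJ : V ⊆ cofinalSet Λ (fun x => LinearMap.ker (T x : E →ₗ[𝕜] F))
      (LinearMap.range (P : F →ₗ[𝕜] E)) := by
    intro x hx
    refine ⟨hx.1, ?_⟩
    change IsSplitting (LinearMap.ker (T x : E →ₗ[𝕜] F)) _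
    rw [hkerQ x hx, ← hrange]
    exact isSplitting_ker_of_isUnit_intertwiner hRR (hRQ x) hx.2.2
  have hJ₀ := (hVJ (mem_of_mem_nhds hV)).2
  refine ⟨mem_interior_iff_mem_nhds.2 (Filter.mem_of_superset hV hVJ), ?_⟩
  -- The co-final set may contain points outside `V`, where the explicit formula is unavailable.
  -- There `α` comes from the splitting alone; on `V`, uniqueness identifies it with the formula.
  have hex : ∀ x, ∃ α : LinearMap.ker (T x₀ : E →ₗ[𝕜] F) →L[𝕜] LinearMap.range (P : F →ₗ[𝕜] E),
      x ∈ cofinalSet Λ (fun x => LinearMap.ker (T x : E →ₗ[𝕜] F))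
        (LinearMap.range (P : F →ₗ[𝕜] E)) →
      IsCoordinateOperator (LinearMap.ker (T x : E →ₗ[𝕜] F)) α := by
    intro x
    by_cases hx : x ∈ cofinalSet Λ (fun x => LinearMap.ker (T x : E →ₗ[𝕜] F))
        (LinearMap.range (P : F →ₗ[𝕜] E))
    · obtain ⟨α, hα⟩ := hJ₀.exists_isCoordinateOperator hx.2
      exact ⟨α, fun _ => hα⟩
    · exact ⟨0, fun h => absurd h hx⟩
  choose α hα using hex
  refine ⟨α, hα, V, hV, hVJ, ?_⟩
  · set p : E →L[𝕜] LinearMap.range (P : F →ₗ[𝕜] E) :=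
      R.codRestrict _ (fun v => ⟨A v, rfl⟩) with hp
    have hcont : ContinuousOn (fun x => -(p ∘L ((intertwiner R (Q x))⁻¹ʳ * Q x) ∘L
        (LinearMap.ker (T x₀ : E →ₗ[𝕜] F)).subtypeL)) V := by
      have hinv : ContinuousOn (fun x => (intertwiner R (Q x))⁻¹ʳ) V := by
        intro x hx
        obtain ⟨u, hu⟩ := hx.2.2
        have h1 : ContinuousAt Ring.inverse (intertwiner R (Q x)) := by
          rw [← hu]; exact NormedRing.inverse_continuousAt u
        exact ContinuousAt.comp_continuousWithinAt (f := fun x => intertwiner R (Q x)) h1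
          ((hDc x hx.1).mono fun y hy => hy.1)
      exact (continuousOn_const.clm_comp
        ((hinv.mul (hQc.mono fun y hy => hy.1)).clm_comp continuousOn_const)).neg
    refine hcont.congr fun x hx => ?_
    refine IsCoordinateOperator.unique hJ₀ (hα x (hVJ hx)) ?_
    rw [hkerQ x hx]
    exact isCoordinateOperator_ker_of_isUnit_intertwiner hRR (hRQ x) hx.2.2 hkerR p fun v => rfl

end Kernels

/-! ### The integral submanifold -/

section Integrability

variable {𝕜 E F : Type*} [RCLike 𝕜] [NormedAddCommGroup E] [NormedSpace 𝕜 E] [CompleteSpace E]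

/-- A `c¹` map whose derivative at `x₀` is the identity restricts to a `c¹` diffeomorphism, with
invertible derivatives, of an open neighbourhood of `x₀` contained in a given one. -/
theorem exists_openPartialHomeomorph_of_hasFDerivAt_id {φ : E → E} {O : Set E} (hO : IsOpen O)
    {x₀ : E} (hx₀ : x₀ ∈ O) (hφ : ContDiffOn 𝕜 1 φ O)
    (hφ₀ : HasFDerivAt φ (ContinuousLinearMap.id 𝕜 E) x₀) :
    ∃ e : OpenPartialHomeomorph E E, (e : E → E) = φ ∧ x₀ ∈ e.source ∧ e.source ⊆ O ∧
      (∀ x ∈ e.source, ∃ L : E ≃L[𝕜] E, HasFDerivAt φ (L : E →L[𝕜] E) x) ∧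
      ContDiffOn 𝕜 1 e.symm e.target := by
  have hφa : ContDiffAt 𝕜 1 φ x₀ := hφ.contDiffAt (hO.mem_nhds hx₀)
  have hφ₀' : HasFDerivAt φ ((ContinuousLinearEquiv.refl 𝕜 E : E ≃L[𝕜] E) : E →L[𝕜] E) x₀ := hφ₀
  set e₀ := hφa.toOpenPartialHomeomorph φ hφ₀' one_ne_zero with he₀
  have hdc : ContinuousOn (fderiv 𝕜 φ) O := hφ.continuousOn_fderiv_of_isOpen hO le_rfl
  -- Invertibility of the derivative on the whole source makes the inverse `c¹` on the whole target,
  -- not only near the image of `x₀`.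
  set O' : Set E := O ∩ fderiv 𝕜 φ ⁻¹' {D | IsUnit D} with hO'
  have hO'o : IsOpen O' := hdc.isOpen_inter_preimage hO Units.isOpen
  have hx₀' : x₀ ∈ O' := by
    refine ⟨hx₀, ?_⟩
    change IsUnit (fderiv 𝕜 φ x₀)
    rw [hφ₀.fderiv]
    exact isUnit_one
  set e := e₀.restrOpen O' hO'o with he
  have hes : e.source = e₀.source ∩ O' := e₀.restrOpen_source O' hO'o
  have hecoe : (e : E → E) = φ := rfl
  have hL : ∀ x ∈ e.source, ∃ L : E ≃L[𝕜] E, HasFDerivAt φ (L : E →L[𝕜] E) x := by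
    intro x hx
    rw [hes] at hx
    obtain ⟨u, hu⟩ := hx.2.2
    refine ⟨ContinuousLinearEquiv.ofUnit u, ?_⟩
    have : ((ContinuousLinearEquiv.ofUnit u : E ≃L[𝕜] E) : E →L[𝕜] E) = fderiv 𝕜 φ x := by
      rw [← hu]; rfl
    rw [this]
    exact ((hφ.contDiffAt (hO.mem_nhds hx.2.1)).differentiableAt one_ne_zero).hasFDerivAt
  refine ⟨e, hecoe, ?_, ?_, hL, ?_⟩
  · rw [hes]
    exact ⟨hφa.mem_toOpenPartialHomeomorph_source hφ₀' one_ne_zero, hx₀'⟩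
  · rw [hes]
    exact fun x hx => hx.2.1
  · intro y hy
    have hx := e.map_target hy
    obtain ⟨L, hL⟩ := hL _ hx
    rw [hes] at hx
    exact (e.contDiffAt_symm hy hL (hφ.contDiffAt (hO.mem_nhds hx.2.1))).contDiffWithinAt

variable [NormedSpace ℝ E] [IsScalarTower ℝ 𝕜 E] [NormedAddCommGroup F] [NormedSpace 𝕜 F]

/-- The kernels of the derivatives of a `c¹` map are integrable at a generalized regular
point. -/
theorem isC1IntegrableAt_kernelFamily {f : E → F} {Λ : Set E} (hΛ : IsOpen Λ) {x₀ : E}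
    (hx₀ : x₀ ∈ Λ) (hf : ContDiffOn 𝕜 1 f Λ) (hreg : IsGeneralizedRegularPoint 𝕜 f x₀) :
    IsC1IntegrableAt Λ (kernelFamily 𝕜 f) x₀ := by
  obtain ⟨B, hB, hker⟩ := IsLocallyFinePoint.exists_ker_eq hreg
  obtain ⟨O₁, hO₁, hO₁o, hxO₁⟩ := eventually_nhds_iff.1 hker
  set A := fderiv 𝕜 f x₀ with hA
  set O := Λ ∩ O₁ with hO
  have hOo : IsOpen O := hΛ.inter hO₁o
  set R : E →L[𝕜] E := B ∘L A with hR
  have hRB : ∀ y, R (B y) = B y := hB.apply_left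
  have hRR : R * R = R := by ext v; exact hRB (A v)
  set g : E → E := fun x => B (f x - f x₀) with hg
  have hgc : ContDiffOn 𝕜 1 g O :=
    B.contDiff.comp_contDiffOn ((hf.mono inter_subset_left).sub contDiffOn_const)
  have hfd : ∀ x ∈ O, HasFDerivAt f (fderiv 𝕜 f x) x := fun x hx =>
    ((hf.contDiffAt (hΛ.mem_nhds hx.1)).differentiableAt one_ne_zero).hasFDerivAt
  have hgd : ∀ x ∈ O, HasFDerivAt g (B ∘L fderiv 𝕜 f x) x := fun x hx =>
    B.hasFDerivAt.comp x ((hfd x hx).sub_const _)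
  set φ : E → E := fun x => (1 - R) (x - x₀) + g x with hφ
  have hφc : ContDiffOn 𝕜 1 φ O :=
    ((1 - R).contDiff.comp_contDiffOn (contDiffOn_id.sub contDiffOn_const)).add hgc
  have hφd : ∀ x ∈ O, HasFDerivAt φ ((1 - R) + B ∘L fderiv 𝕜 f x) x := fun x hx =>
    ((1 - R).hasFDerivAt.comp x ((hasFDerivAt_id x).sub_const x₀)).add (hgd x hx)
  have hφ₀ : HasFDerivAt φ (ContinuousLinearMap.id 𝕜 E) x₀ := by
    have h := hφd x₀ ⟨hx₀, hxO₁⟩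
    rwa [show (1 - R) + B ∘L fderiv 𝕜 f x₀ = ContinuousLinearMap.id 𝕜 E from
      sub_add_cancel _ _] at h
  have hRφ : ∀ x, R (φ x) = g x := by
    intro x
    have h1 : ∀ v, R ((1 - R) v) = 0 := fun v => by
      simpa using sub_eq_zero.2 (DFunLike.congr_fun hRR v).symm
    rw [hφ]
    simp only [map_add, h1, zero_add]
    exact hRB _
  obtain ⟨e, hecoe, hxe, heO, heL, hesymm⟩ :=
    exists_openPartialHomeomorph_of_hasFDerivAt_id hOo ⟨hx₀, hxO₁⟩ hφc hφ₀
  have hsplit : IsSplitting (LinearMap.ker (R : E →ₗ[𝕜] E)) (LinearMap.range (R : E →ₗ[𝕜] E)) :=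
    isSplitting_ker_of_isUnit_intertwiner hRR hRR
      (by rw [intertwiner, sub_add_cancel]; exact isUnit_one)
  refine ⟨{x | x ∈ e.source ∧ g x = 0}, fun x hx => (heO hx.1).1, ⟨hxe, by simp [hg]⟩, ?_, ?_⟩
  · intro x hx
    refine ⟨_, _, hsplit, e, hx.1, hecoe ▸ hφc.mono heO, hesymm, e.target, e.open_target, ?_⟩
    ext y
    constructor
    · rintro ⟨z, ⟨⟨hz, hgz⟩, -⟩, rfl⟩
      refine ⟨e.map_source hz, ?_⟩
      change R _ = 0
      rw [hecoe, hRφ, hgz]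
    · rintro ⟨hy, hRy⟩
      refine ⟨e.symm y, ⟨⟨e.map_target hy, ?_⟩, e.map_target hy⟩, e.right_inv hy⟩
      have hRy' : R y = 0 := hRy
      rw [← hRφ, ← hecoe, e.right_inv hy, hRy']
  · rintro x ⟨hxs, hgx⟩
    have hxO := heO hxs
    ext v
    constructor
    · intro hv
      have hv' : fderiv 𝕜 f x v = 0 := hv
      -- As `f'(x) v = 0`, the derivative of `φ` at `x` sends `v` to `(1 - R) v = w`. The line `φ x
      -- + t w` stays in `N(R)`, so its pullback by `φ` is a curve in the submanifold with velocity
      -- `v`.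
      set w : E := (1 - R) v with hw
      have hRw : R w = 0 := by
        rw [hw]
        simpa using sub_eq_zero.2 (DFunLike.congr_fun hRR v).symm
      set l : ℝ → E := fun t => e x + t • w with hl
      have hlc : ContDiff ℝ 1 l := contDiff_const.add (contDiff_id.smul contDiff_const)
      have hl0 : l 0 = e x := by simp [hl]
      have hmem : l ⁻¹' e.target ∈ 𝓝 (0 : ℝ) :=
        hlc.continuous.continuousAt.preimage_mem_nhds
          (e.open_target.mem_nhds (by rw [hl0]; exact e.map_source hxs))
      obtain ⟨ε, hε, hball⟩ := Metric.mem_nhds_iff.1 hmem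
      rw [Real.ball_eq_Ioo, zero_sub, zero_add] at hball
      refine ⟨fun t => e.symm (l t), ε, hε, ?_, ?_, ?_, ?_⟩
      · exact (hesymm.restrict_scalars ℝ).comp hlc.contDiffOn hball
      · intro t ht
        refine ⟨e.map_target (hball ht), ?_⟩
        have h1 : ∀ r : ℝ, R (r • w) = 0 := fun r => by
          rw [← algebraMap_smul 𝕜 r w, map_smul, hRw, smul_zero]
        rw [← hRφ, ← hecoe, e.right_inv (hball ht)]
        change R (e x + t • w) = 0
        rw [map_add, h1, add_zero, hecoe, hRφ, hgx]
      · change e.symm (l 0) = x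
        rw [hl0, e.left_inv hxs]
      · obtain ⟨L, hL⟩ := heL x hxs
        have hLv : L v = w := by
          have h := DFunLike.congr_fun (hL.unique (hφd x hxO)) v
          simpa [hv', hw] using h
        have hsd : HasFDerivAt e.symm ((L.symm : E ≃L[𝕜] E) : E →L[𝕜] E) (l 0) := by
          rw [hl0]
          refine e.hasFDerivAt_symm (e.map_source hxs) ?_
          rw [e.left_inv hxs, hecoe]
          exact hL
        have hld : HasDerivAt l w 0 := by
          simpa [hl] using ((hasDerivAt_id (0 : ℝ)).smul_const w).const_add (e x)
        have h := (hsd.restrictScalars ℝ).comp_hasDerivAt 0 hld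
        have hLw : L.symm w = v := by rw [← hLv, L.symm_apply_apply]
        have h' : ((L.symm : E →L[𝕜] E).restrictScalars ℝ) w = v := hLw
        rw [h'] at h
        exact h
    · rintro ⟨c, ε, hε, -, hcS, hc0, hcd⟩
      change fderiv 𝕜 f x v = 0
      -- Fineness at `x` itself, not only at `x₀`, reduces the claim to `B f'(x) v = 0`, which
      -- follows because `g` vanishes along `c`.
      rw [hO₁ x hxO.2]
      have h1 : HasFDerivAt g (B ∘L fderiv 𝕜 f x) (c 0) := by rw [hc0]; exact hgd x hxO
      have h2 := (h1.restrictScalars ℝ).comp_hasDerivAt 0 hcd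
      have h3 : (g ∘ c) =ᶠ[𝓝 0] fun _ => (0 : E) := by
        filter_upwards [Ioo_mem_nhds (neg_lt_zero.2 hε) hε] with t ht using (hcS t ht).2
      exact h2.unique ((hasDerivAt_const (0 : ℝ) (0 : E)).congr_of_eventuallyEq h3)

end Integrability

theorem theorem3p1 {𝕜 E F : Type*} [RCLike 𝕜]
    [NormedAddCommGroup E] [NormedSpace 𝕜 E] [CompleteSpace E]
    [NormedSpace ℝ E] [IsScalarTower ℝ 𝕜 E]
    [NormedAddCommGroup F] [NormedSpace 𝕜 F] [CompleteSpace F]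
    (U : Set E) (hU : IsOpen U) (f : E → F) (hf : ContDiffOn 𝕜 1 f U)
    (x₀ : E) (hx₀ : x₀ ∈ U) (hreg : IsGeneralizedRegularPoint 𝕜 f x₀)
    (U₀ : Set E) (hU₀ : IsOpen U₀) (hx₀U₀ : x₀ ∈ U₀) (hU₀U : U₀ ⊆ U) :
    (∀ T₀p : F →L[𝕜] E, IsGeneralizedInverse (fderiv 𝕜 f x₀) T₀p →
      IsTrivialCofinalSet U₀ (kernelFamily 𝕜 f) x₀ (LinearMap.range (T₀p : F →ₗ[𝕜] E))) ∧
    IsC1IntegrableAt U₀ (kernelFamily 𝕜 f) x₀ := by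
  have hf₀ : ContDiffOn 𝕜 1 f U₀ := hf.mono hU₀U
  exact ⟨fun T₀p hT₀p => isTrivialCofinalSet_ker hU₀ hx₀U₀
    (hf₀.continuousOn_fderiv_of_isOpen hU₀ le_rfl) hreg hT₀p,
    isC1IntegrableAt_kernelFamily hU₀ hx₀U₀ hf₀ hreg⟩
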